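/- Let $N$ be a nonzero integer and let $\mathcal Y$ be a scheme locally of finite type over $\mathbf Z[\frac1N]$ with nonempty generic fibre $\mathcal Y_{\mathbf Q}$. Let $\mathcal M(\mathbf Z)$ be the Berkovich spectrum of $\mathbf Z$ (multiplicative seminorms on $\mathbf Z$, with the topology of pointwise convergence), let $a_0$ be the point given by the trivial absolute value and, for a place $v\in M_{\mathbf Q}$, let $a_v$ be the point given by the normalized absolute value $|\cdot|_v$. For $n\in\mathbf Z$ put $\mathcal U_n=\{x\in\mathcal M(\mathbf Z): |n|_x\neq 0\}$. Let $Y=\mathcal Y^{\mathrm{an}}$ be the Berkovich analytification of $\mathcal Y$: its points are the pairs $y=(x,|\cdot|_y)$ with $x\in\mathcal Y$ and $|\cdot|_y$ an absolute value on the residue field $\kappa(x)$, with the coarsest topology for which, for every affine open $U\subset\mathcal Y$ and every $f\in\mathcal O(U)$, the set $U^{\mathrm{an}}$ is open and $|f|$ is continuous on it. Let $\mathrm{pr}\colon Y\to\mathcal M(\mathbf Z)$ be the projection. For $y=(x,|\cdot|_y)\in Y$ and $\varepsilon>0$ such that $|\cdot|_y^\varepsilon$ is still an absolute value (always the case if $\varepsilon\le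 1$), put $y^\varepsilon=(x,|\cdot|_y^\varepsilon)$. A subset $V\subset Y$ is called floating if $y^\varepsilon\in V$ for all $y\in V$ and all $\varepsilon>0$ for which $y^\varepsilon$ is defined. A function $f$ on $V$ is called $\log$-floating if $f(y^\varepsilon)=\varepsilon f(y)$ for all $y\in V$ and $\varepsilon\in(0,1]$. For $Q\in\mathcal Y(\overline{\mathbf Q})$, with residue field $\kappa(Q)$, a finite extension of $\mathbf Q$, let $L_v(Q)$ be the finite set of points of $\mathrm{pr}^{-1}(a_v)$ determined by $Q$, that is, of absolute values on $\kappa(Q)$ extending $|\cdot|_v$, and put $L(Q)=\bigcup_{v\in M_{\mathbf Q}}L_v(Q)$. For $q\in L_v(Q)$, with completed residue field $\mathcal H(q)$, put $N_q=[\mathcal H(q):\mathbf Q_v]/[\kappa(Q):\mathbf Q]$. **Theorem.** Let $V\subset Y$ be a floating subset such that $\mathrm{pr}(V)=\mathcal U_{N_V}$ for some $N_V\in\mathbf Z$. Let $\mathcal E,f_1\colon V\to\mathbf R_{\ge0}$, $f_2\colon V\to\mathbf R$ and $g_1\colon V\to\mathbf R\cup\{-\infty\}$ be continuous $\log$-floating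 functions. For $s,t>0$ put $V_s=\{y\in V: f_1(y)\le s\}$ and $W_t=\{y\in V: g_1(y)\le t f_2(y)\}$. Assume that 1. for all $s,t>0$, the map $\mathrm{pr}\colon V_s\cap W_t\to\mathcal U_{N_V}$ is proper; 2. there are $A>0$ and a family $(B_v)_{v\in M_{\mathbf Q}}$ of real numbers, almost all zero, such that $g_1(y)\le A f_1(y)+B_v$ for all $v\in M_{\mathbf Q}$ and $y\in V\cap\mathrm{pr}^{-1}(a_v)$; 3. there are $r_0>0$ and $\tau\colon\mathbf R_{>0}\to\mathbf R_{>0}$ with $\lim_{r\to+\infty}\tau(r)=+\infty$ such that $\mathcal E(y)\ge\frac1r f_2(y)$ for all $r\ge r_0$ and $y\in W_{\tau(r)}\cap\mathrm{pr}^{-1}(a_0)$. Then, for every $\varepsilon>0$, there are $C>0$ and $D\in\mathbf R$ such that, for every $Q\in\mathcal Y(\overline{\mathbf Q})$, $$\sum_{q\in L_{f_1}(Q)\cap V}N_q\,\mathcal E(q)\ \ge\ C\Big(\sum_{q\in L_{f_1}(Q)\cap V}N_q f_2(q)-\varepsilon\sum_{q\in L(Q)\cap V}N_q f_1(q)\Big)+D,$$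 where $L_{f_1}(Q)\cap V=\{q\in L(Q)\cap V: f_1(q)>0\}$. Here the sums are taken in $[-\infty,+\infty]$, the sum of $N_qf_2(q)$ being the difference of the sums of the positive and of the negative parts. If $\sum_{q\in L(Q)\cap V}N_qf_1(q)$ is finite, then so is $\sum_{q\in L_{f_1}(Q)\cap V}N_q\max(f_2(q),0)$, so that the right-hand side is well defined; if it is infinite, the right-hand side is read as $-\infty$. -/

import Mathlib

open AlgebraicGeometry CategoryTheory Topology Filter
open scoped NNReal ENNReal

noncomputable section

/-! ### The Berkovich spectrum of `ℤ` -/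

/-- The Berkovich spectrum `M(ℤ)`: the set of multiplicative seminorms on `ℤ`.  (Boundedness by
the usual absolute value is automatic, by the triangle inequality.) -/
def BerkovichInt : Type := MulRingSeminorm ℤ

namespace BerkovichInt

/-- The value `|n|_x` of the integer `n` at the point `x`. -/
def val (x : BerkovichInt) (n : ℤ) : ℝ :=
  MulRingSeminorm.toAddGroupSeminorm (R := ℤ) x n

/-- The topology of `M(ℤ)` is that of pointwise convergence. -/
instance : TopologicalSpace BerkovichInt :=
  TopologicalSpace.induced (fun x n => x.val n) inferInstance

/-- The point of `M(ℤ)` obtained by pulling back an absolute value on a field. -/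
def ofAbs {K : Type*} [Field K] (a : AbsoluteValue K ℝ) : BerkovichInt :=
  ({ toFun := fun n => a (n : K)
     map_zero' := by simp
     add_le' := fun m n => by push_cast; exact a.add_le _ _
     neg' := fun n => by push_cast; exact a.map_neg _
     map_one' := by simp
     map_mul' := fun m n => by push_cast; exact a.map_mul _ _ } : MulRingSeminorm ℤ)

/-- The open subset `U_N` of `M(ℤ)` where `N` does not vanish. -/
def U (N : ℤ) : Set BerkovichInt := {x | x.val N ≠ 0}

open Classical in
/-- The central point `a₀`, associated with the trivial absolute value. -/
def center : BerkovichInt := ofAbs (AbsoluteValue.trivial : AbsoluteValue ℚ ℝ)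

end BerkovichInt

/-- The set `M_ℚ` of places of `ℚ`. -/
inductive RatPlace : Type
  | infinite : RatPlace
  | finite (p : Nat.Primes) : RatPlace

namespace RatPlace

/-- The normalized absolute value on `ℚ` associated with a place: the usual one, or the `p`-adic
one with `|p| = 1 / p`. -/
def abs : RatPlace → AbsoluteValue ℚ ℝ
  | infinite => Rat.AbsoluteValue.real
  | finite p =>
    haveI : Fact (p : ℕ).Prime := ⟨p.2⟩
    Rat.AbsoluteValue.padic p

/-- The point `a_v` of `M(ℤ)` associated with the normalized absolute value at `v`. -/
def point (v : RatPlace) : BerkovichInt := BerkovichInt.ofAbs v.abs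

end RatPlace

/-! ### The analytification of a scheme over `ℤ[1/N]` -/

/-- The underlying set of the Berkovich analytification of a scheme `X` locally of finite type
over `ℤ[1/N]`: a point is a point of the scheme together with an absolute value on its residue
field.  For `X = Spec R` affine, this is the set of multiplicative seminorms on `R`; no bound on
the scalars has to be imposed since every multiplicative seminorm on `ℤ` is bounded by the usual
absolute value. -/
structure Analytification (X : Scheme.{0}) where
  /-- The underlying point of the scheme. -/
  pt : X
  /-- The absolute value on the residue field. -/
  abs : AbsoluteValue (X.residueField pt) ℝ

namespace Analytification

variable {X : Scheme.{0}}

/-- The coarsest topology for which, for every affine open subscheme `U` and every `f` in `O(U)`,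
the set of points lying over `U` is open and `|f|` is continuous on it. -/
instance : TopologicalSpace (Analytification X) :=
  TopologicalSpace.generateFrom
    {S | ∃ U : X.affineOpens, ∃ f : Γ(X, U.1), ∃ T : Set ℝ, IsOpen T ∧
      S = {y | ∃ h : y.pt ∈ U.1, y.abs ((X.evaluation U.1 y.pt h).hom f) ∈ T}}

/-- The projection to `M(ℤ)`. -/
def pr (y : Analytification X) : BerkovichInt := BerkovichInt.ofAbs y.abs

/-- `IsPow ε y y'` means that `y ^ ε` is defined and equal to `y'`: both points lie over the same
point of the scheme, and the absolute value of `y'` is the `ε`-th power of that of `y`. -/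
def IsPow (ε : ℝ) (y y' : Analytification X) : Prop :=
  ∃ b : AbsoluteValue (X.residueField y.pt) ℝ, (∀ t, b t = y.abs t ^ ε) ∧ y' = ⟨y.pt, b⟩

/-- A part of the analytification is floating if it is stable under the flow: it contains `y ^ ε`
whenever it contains `y`, `ε > 0` and `y ^ ε` is defined. -/
def IsFloating (V : Set (Analytification X)) : Prop :=
  ∀ y ∈ V, ∀ ε : ℝ, 0 < ε → ∀ y', IsPow ε y y' → y' ∈ V

/-- A function `f` on `V` is log-floating if `f (y ^ ε) = ε f(y)` for all `y` and `0 < ε ≤ 1`. -/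
def IsLogFloating (V : Set (Analytification X)) (f : V → EReal) : Prop :=
  ∀ y y' : V, ∀ ε : ℝ, 0 < ε → ε ≤ 1 → IsPow ε y.1 y'.1 → f y' = (ε : EReal) * f y

/-- The restriction `V → U_N` of the projection, for a part `V` with image `U_N`. -/
def prRestrict (V : Set (Analytification X)) (N : ℤ) (h : pr '' V = BerkovichInt.U N) (y : V) :
    BerkovichInt.U N :=
  ⟨pr y.1, h ▸ Set.mem_image_of_mem pr y.2⟩

/-- The point of the scheme underlying a `ℚ̄`-point. -/
def underlying (Q : Spec (.of (AlgebraicClosure ℚ)) ⟶ X) : X :=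
  Q (IsLocalRing.closedPoint (AlgebraicClosure ℚ))

/-- The set `L_v(Q)` of points of `X^an` over the place `v` determined by the `ℚ̄`-point `Q`: the
absolute values on the residue field `κ(Q)` extending the normalized absolute value at `v`. -/
def localPoints (Q : Spec (.of (AlgebraicClosure ℚ)) ⟶ X) (v : RatPlace) :
    Set (Analytification X) :=
  {y | y.pt = underlying Q ∧ pr y = v.point}

/-- The union `L(Q)` of the `L_v(Q)` over all places. -/
def adelicPoints (Q : Spec (.of (AlgebraicClosure ℚ)) ⟶ X) : Set (Analytification X) :=
  ⋃ v, localPoints Q v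

/-- The completed residue field `H(y)`. -/
abbrev H (y : Analytification X) : Type := y.abs.Completion

/-- The weight `N_q = [H(q) : ℚ_v] / [κ(Q) : ℚ]`, for `q` in `L_v(Q)`.  Here `ℚ_v` is the closure
in `H(q)` of its prime field `ℚ`, and `ℚ` is the prime field of `κ(Q)`. -/
def weight (q : Analytification X) : ℝ≥0 :=
  (Module.finrank (⊥ : Subfield (H q)).topologicalClosure (H q) : ℝ≥0) /
    (Module.finrank (⊥ : Subfield (X.residueField q.pt)) (X.residueField q.pt) : ℝ≥0)

/-- The sum in `[0, +∞]` of the `N_q φ⁺(q)`, for `q` in `S`, where `φ⁺ = max(φ, 0)`. -/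
def posSum {V : Set (Analytification X)} (S : Set V) (φ : V → ℝ) : ℝ≥0∞ :=
  ∑' q : S, (weight q.1.1 : ℝ≥0∞) * ENNReal.ofReal (φ q.1)

/-- The sum of the `N_q φ(q)`, for `q` in `S`: the difference of the sum of the positive parts
and the sum of the negative parts.  (It is meaningful as soon as one of the two is finite, in
particular when `φ` is nonnegative.) -/
def weightedSum {V : Set (Analytification X)} (S : Set V) (φ : V → ℝ) : EReal :=
  (posSum S φ : EReal) - (posSum S (fun q => - φ q) : EReal)

end Analytification

end

/-! Everything rests on a local inequality f₂(q) ≤ c·E(q) + ε·f₁(q) + M_v for q over a_v with f₁(q)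
> 0, where M_v ≥ 0 depends on v only and almost always vanishes (`exists_pointwise_bound`). When it
is summed with the weights N_q, the constants contribute at most ∑ M_v, because the weights over one
place add up to at most 1 (`sum_weight_le_one`). Hence C = 1/c and D = -(∑ M_v)/c.

The local inequality needs proof only where f₂ > ε f₁. There condition 2 puts q in W_t, with t
independent of q and v, except at finitely many v where f₂ ≥ 1 must also be assumed. All functions
are homogeneous under the flow, so q may be normalized to f₁ = 1. Over a_0, condition 3 gives f₂ ≤ r
E; properness spreads this, with 2r for r, to a neighbourhood O of a_0 (`exists_mem_nhds_center`).
Now O contains almost all branches of M(ℤ) entirely and an initial segment of each other one. The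
points not normalized into O lie in compact sets over finitely many a_v, where f₂ is bounded. -/

/-! ### Local degrees and the weights N_q. -/

/-- The local degrees of a family of fields in which `K` is densely and diagonally embedded are
bounded by the degree of `K`. -/
theorem sum_finrank_le_of_denseRange {k : Type*} [NontriviallyNormedField k] [CompleteSpace k]
    {ι : Type*} [Fintype ι] {L : ι → Type*} [∀ i, NormedField (L i)]
    (φ : ∀ i, k →+* L i) (hφ : ∀ i, Continuous (φ i)) {K : Type*} [Field K] (ψ : ∀ i, K →+* L i)
    (hψ : DenseRange (fun (x : K) i => ψ i x)) (F : Subfield K) [Module.Finite F K]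
    (hF : ∀ c ∈ F, ∃ d : k, ∀ i, ψ i c = φ i d)
    (S : ∀ i, Subfield (L i)) (hS : ∀ i d, φ i d ∈ S i) :
    ∑ i, Module.finrank (S i) (L i) ≤ Module.finrank F K := by
  let (i : ι) : Algebra k (L i) := (φ i).toAlgebra
  have (i : ι) : ContinuousSMul k (L i) :=
    ⟨((hφ i).comp continuous_fst).mul continuous_snd⟩
  let b := Module.finBasis F K
  let e : Fin (Module.finrank F K) → ∀ i, L i := fun j i => ψ i (b j)
  let P := Submodule.span k (Set.range e)
  have hmem : ∀ x : K, (fun i => ψ i x) ∈ P := by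
    intro x
    choose d hd using fun j => hF (b.repr x j) (b.repr x j).2
    have : (fun i => ψ i x) = ∑ j, d j • e j := by
      funext i
      conv_lhs => rw [← b.sum_repr x]
      rw [map_sum, Finset.sum_apply]
      refine Finset.sum_congr rfl fun j _ => ?_
      rw [Subfield.smul_def, smul_eq_mul, map_mul, hd j i]
      rfl
    rw [this]
    exact Submodule.sum_mem _ fun j _ =>
      Submodule.smul_mem _ _ (Submodule.subset_span (Set.mem_range_self j))
  -- A finite-dimensional subspace over a complete field is closed, and `P` contains the dense image
  -- of `K`.
  have hP : P = ⊤ := by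
    have : FiniteDimensional k P := FiniteDimensional.span_of_finite k (Set.finite_range e)
    have hc : IsClosed (P : Set (∀ i, L i)) := P.closed_of_finiteDimensional
    rw [← SetLike.coe_set_eq, Submodule.top_coe, ← Set.univ_subset_iff, ← hψ.closure_eq]
    exact hc.closure_subset_iff.2 (Set.range_subset_iff.2 hmem)
  have : Module.Finite k (∀ i, L i) := ⟨by
    rw [← hP]
    exact Submodule.fg_span (Set.finite_range e)⟩
  have (i : ι) : Module.Finite k (L i) :=
    Module.Finite.of_surjective (LinearMap.proj (R := k) (φ := L) i)
      (Function.surjective_eval i)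
  -- `S i` contains the image of `k`, so a `k`-basis of `L i` still spans over `S i`.
  calc ∑ i, Module.finrank (S i) (L i) ≤ ∑ i, Module.finrank k (L i) := by
        refine Finset.sum_le_sum fun i _ => ?_
        let c := Module.finBasis k (L i)
        have hc : Submodule.span (S i) (Set.range c) = ⊤ := by
          rw [eq_top_iff]
          intro x _
          rw [← c.sum_repr x]
          refine Submodule.sum_mem _ fun j _ => ?_
          exact Submodule.smul_mem _ (⟨φ i (c.repr x j), hS i _⟩ : S i)
            (Submodule.subset_span (Set.mem_range_self j))
        have := finrank_range_le_card (R := S i) c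
        rwa [Set.finrank, hc, finrank_top, Fintype.card_fin] at this
    _ = Module.finrank k (∀ i, L i) := (Module.finrank_pi_fintype k).symm
    _ ≤ Module.finrank F K := by
        have := finrank_range_le_card (R := k) e
        rwa [Set.finrank, show Submodule.span k (Set.range e) = ⊤ from hP, finrank_top,
          Fintype.card_fin] at this

theorem AbsoluteValue.ext_rat_of_int {a b : AbsoluteValue ℚ ℝ} (h : ∀ n : ℤ, a n = b n) :
    a = b := by
  ext q
  rw [← Rat.num_div_den q, map_div₀, map_div₀]
  have := h q.den
  simp only [Int.cast_natCast] at this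
  rw [h, this]

/-- The degrees of the completions of `K` at distinct absolute values extending a given nontrivial
absolute value on `ℚ` add up to at most the degree of `K`. -/
theorem sum_finrank_completion_le {K : Type*} [Field K]
    [Module.Finite (⊥ : Subfield K) K] (a : AbsoluteValue ℚ ℝ) (ha : a.IsNontrivial)
    (T : Finset (AbsoluteValue K ℝ)) (hT : ∀ w ∈ T, ∀ n : ℤ, w n = a n) :
    ∑ w ∈ T, Module.finrank (⊥ : Subfield w.Completion).topologicalClosure w.Completion ≤
      Module.finrank (⊥ : Subfield K) K := by
  classical
  rcases T.eq_empty_or_nonempty with rfl | ⟨w₀, hw₀⟩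
  · simp
  have : CharZero K := by
    refine charZero_of_inj_zero fun n hn => ?_
    have := (hT w₀ hw₀ n).symm
    simpa [hn] using this
  have hrat : ∀ w ∈ T, ∀ x : ℚ, w (algebraMap ℚ K x) = a x := by
    intro w hw x
    have := AbsoluteValue.ext_rat_of_int (a := w.comp (algebraMap ℚ K).injective) (b := a)
      
      (fun n => by rw [← hT w hw n]; exact congrArg w (map_intCast (algebraMap ℚ K) n))
    rw [← this]; rfl
  have hiso : ∀ w : T, Isometry (WithAbs.map a w.1 (algebraMap ℚ K)) := fun w =>
    AddMonoidHomClass.isometry_of_norm _ fun x => hrat w.1 w.2 x.ofAbs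
  let : NontriviallyNormedField a.Completion :=
    { (inferInstance : NormedField a.Completion) with
      non_trivial := by
        obtain ⟨x, hx⟩ := ha.exists_abv_gt_one
        exact ⟨((WithAbs.toAbs a x : WithAbs a) : a.Completion), by
          rw [UniformSpace.Completion.norm_coe]; exact hx⟩ }
  let φ (w : T) : a.Completion →+* w.1.Completion :=
    UniformSpace.Completion.mapRingHom _ (hiso w).continuous
  have hφ (w : T) : Continuous (φ w) := UniformSpace.Completion.continuous_map
  let ψ (w : T) : K →+* w.1.Completion :=
    UniformSpace.Completion.coeRingHom.comp (WithAbs.equiv w.1).symm.toRingHom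
  have hψ : DenseRange (fun (x : K) w => ψ w x) := by
    -- Weak approximation for nontrivial, pairwise inequivalent absolute values.
    have h1 : DenseRange (algebraMap K ((w : T) → WithAbs w.1)) := by
      refine AbsoluteValue.denseRange_algebraMap_pi (fun w => ?_) fun w w' hne he => hne ?_
      · obtain ⟨x, hx0, hx⟩ := ha
        exact ⟨algebraMap ℚ K x, by simpa using hx0, by rwa [hrat w.1 w.2]⟩
      -- Equivalent absolute values are powers of one another; a common nontrivial restriction to ℚ
      -- forces the exponent 1.
      · obtain ⟨c, hc, h⟩ := AbsoluteValue.isEquiv_iff_exists_rpow_eq.1 he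
        obtain ⟨x, hx⟩ := ha.exists_abv_gt_one
        have h2 := congrFun h (algebraMap ℚ K x)
        simp only [hrat w.1 w.2, hrat w'.1 w'.2] at h2
        have hc1 : c = 1 := by
          refine (Real.rpow_right_inj (zero_lt_one.trans hx) hx.ne').1 ?_
          rw [h2, Real.rpow_one]
        ext x
        have := congrFun h x
        simpa [hc1] using this
    have h2 : DenseRange (Pi.map fun (w : T) (x : WithAbs w.1) => (x : w.1.Completion)) :=
      DenseRange.piMap fun w => UniformSpace.Completion.denseRange_coe
    exact h2.comp h1 (continuous_pi fun w =>
      (UniformSpace.Completion.continuous_coe _).comp (continuous_apply w))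
  have key := sum_finrank_le_of_denseRange φ hφ ψ hψ ⊥ ?_
    (fun w => (⊥ : Subfield w.1.Completion).topologicalClosure) ?_
  · rwa [Finset.sum_coe_sort T
      (fun w => Module.finrank (⊥ : Subfield w.Completion).topologicalClosure w.Completion)] at key
  · intro c hc
    have : (⊥ : Subfield K) ≤ (algebraMap ℚ K).fieldRange := bot_le
    obtain ⟨x, rfl⟩ := this hc
    refine ⟨((WithAbs.toAbs a x : WithAbs a) : a.Completion), fun w => ?_⟩
    exact (UniformSpace.Completion.mapRingHom_coe (hiso w).continuous _).symm
  · intro w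
    have hcl : IsClosed {d : a.Completion |
        φ w d ∈ (⊥ : Subfield w.1.Completion).topologicalClosure} :=
      (Subfield.isClosed_topologicalClosure _).preimage (hφ w)
    intro d
    refine UniformSpace.Completion.induction_on d hcl fun x => ?_
    have h0 : φ w (x : a.Completion) ∈ (⊥ : Subfield w.1.Completion) := by
      rw [show φ w (x : a.Completion) = ((φ w).comp (UniformSpace.Completion.coeRingHom.comp
        (WithAbs.equiv a).symm.toRingHom)) x.ofAbs from rfl, eq_ratCast]
      exact SubfieldClass.ratCast_mem _ _
    exact Subfield.le_topologicalClosure _ h0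

theorem RatPlace.abs_isNontrivial (v : RatPlace) : v.abs.IsNontrivial := by
  cases v with
  | infinite => exact ⟨2, by norm_num, by simp [RatPlace.abs]⟩
  | finite p =>
    have : Fact (p : ℕ).Prime := ⟨p.2⟩
    exact ⟨(p : ℕ), by exact_mod_cast p.2.ne_zero, by simp [RatPlace.abs, p.2.ne_one]⟩

namespace Analytification

variable {X : Scheme.{0}}

theorem abs_intCast_of_pr_eq {q : Analytification X} {v : RatPlace} (h : pr q = v.point) (n : ℤ) :
    q.abs n = v.abs n :=
  congrArg (fun x : BerkovichInt => x.val n) h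

/-- The weights of the points over a place of `ℚ` that lie over a given point of the scheme add up
to at most one. -/
theorem sum_weight_le_one (x : X) (v : RatPlace) (T : Finset (Analytification X))
    (hT : ∀ q ∈ T, q.pt = x ∧ pr q = v.point) : ∑ q ∈ T, weight q ≤ 1 := by
  classical
  by_cases hfin : Module.Finite (⊥ : Subfield (X.residueField x)) (X.residueField x)
  · let j : AbsoluteValue (X.residueField x) ℝ → Analytification X := fun w => ⟨x, w⟩
    have hj : Function.Injective j := fun w w' h => by simpa [j] using h
    have hTj : T = (T.preimage j hj.injOn).image j := by
      ext q
      simp only [Finset.mem_image, Finset.mem_preimage]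
      constructor
      · intro hq
        obtain ⟨y, w⟩ := q
        obtain rfl : y = x := (hT _ hq).1
        exact ⟨w, hq, rfl⟩
      · rintro ⟨w, hw, rfl⟩
        exact hw
    rw [hTj, Finset.sum_image hj.injOn]
    rw [show ∑ w ∈ T.preimage j hj.injOn, weight (j w) =
      (∑ w ∈ T.preimage j hj.injOn,
        (Module.finrank (⊥ : Subfield w.Completion).topologicalClosure w.Completion : ℝ≥0)) /
        (Module.finrank (⊥ : Subfield (X.residueField x)) (X.residueField x) : ℝ≥0) from by
      rw [Finset.sum_div]; rfl]
    refine div_le_one_of_le₀ ?_ zero_le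
    exact_mod_cast sum_finrank_completion_le v.abs v.abs_isNontrivial (T.preimage j hj.injOn)
      fun w hw n => abs_intCast_of_pr_eq (hT _ (Finset.mem_preimage.1 hw)).2 n
  -- The degree in the denominator is then the default 0, and division by 0 makes every weight 0.
  · rw [Finset.sum_eq_zero]
    · exact zero_le_one
    · rintro ⟨y, w⟩ hq
      obtain rfl : y = x := (hT _ hq).1
      rw [weight, Module.finrank_of_not_finite hfin, Nat.cast_zero, div_zero]

theorem tsum_weight_le_one (Q : Spec (.of (AlgebraicClosure ℚ)) ⟶ X) (v : RatPlace) :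
    ∑' q : localPoints Q v, (weight q.1 : ℝ≥0∞) ≤ 1 := by
  classical
  refine ENNReal.summable.tsum_le_of_sum_le fun T => ?_
  have h := sum_weight_le_one (underlying Q) v (T.map (Function.Embedding.subtype _)) (by
    intro q hq
    obtain ⟨q, -, rfl⟩ := Finset.mem_map.1 hq
    exact q.2)
  rw [Finset.sum_map] at h
  exact_mod_cast h

end Analytification

/-! ### Powers of absolute values. -/

theorem AbsoluteValue.exists_rpow {K : Type*} [Field K] (w : AbsoluteValue K ℝ) {η : ℝ}
    (hη : 0 < η) (h : ∀ x y, w (x + y) ^ η ≤ w x ^ η + w y ^ η) :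
    ∃ b : AbsoluteValue K ℝ, ∀ x, b x = w x ^ η :=
  ⟨{ toFun := fun x => w x ^ η
     map_mul' := fun x y => by rw [map_mul, Real.mul_rpow (w.nonneg _) (w.nonneg _)]
     nonneg' := fun x => Real.rpow_nonneg (w.nonneg _) _
     eq_zero' := fun x => by rw [Real.rpow_eq_zero (w.nonneg _) hη.ne', w.eq_zero]
     add_le' := h }, fun _ => rfl⟩

theorem AbsoluteValue.exists_rpow_of_le_one {K : Type*} [Field K] (w : AbsoluteValue K ℝ) {η : ℝ}
    (hη : 0 < η) (hη1 : η ≤ 1) : ∃ b : AbsoluteValue K ℝ, ∀ x, b x = w x ^ η :=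
  w.exists_rpow hη fun x y =>
    (Real.rpow_le_rpow (w.nonneg _) (w.add_le x y) hη.le).trans
      (Real.rpow_add_le_add_rpow (w.nonneg _) (w.nonneg _) hη.le hη1)

/-- Such an absolute value is ultrametric, and the ultrametric inequality survives any positive
power. At finite places the flow is therefore defined for all exponents. -/
theorem AbsoluteValue.exists_rpow_of_natCast_le_one {K : Type*} [Field K] (w : AbsoluteValue K ℝ)
    (hw : ∀ n : ℕ, w n ≤ 1) {η : ℝ} (hη : 0 < η) :
    ∃ b : AbsoluteValue K ℝ, ∀ x, b x = w x ^ η := by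
  have : IsUltrametricDist (WithAbs w) :=
    IsUltrametricDist.isUltrametricDist_of_forall_norm_natCast_le_one fun n => hw n
  refine w.exists_rpow hη fun x y => ?_
  have hx := Real.rpow_nonneg (w.nonneg x) η
  have hy := Real.rpow_nonneg (w.nonneg y) η
  have h : w (x + y) ≤ max (w x) (w y) :=
    IsUltrametricDist.norm_add_le_max (WithAbs.toAbs w x) (WithAbs.toAbs w y)
  rcases le_max_iff.1 h with h | h
  · exact (Real.rpow_le_rpow (w.nonneg _) h hη.le).trans (le_add_of_nonneg_right hy)
  · exact (Real.rpow_le_rpow (w.nonneg _) h hη.le).trans (le_add_of_nonneg_left hx)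

/-! ### Neighbourhoods of the central point of M(ℤ). -/

namespace BerkovichInt

theorem center_val_zero : center.val 0 = 0 := by
  simp [center, val, ofAbs]

theorem center_val_of_ne_zero {n : ℤ} (hn : n ≠ 0) : center.val n = 1 := by
  classical
  have : (n : ℚ) ≠ 0 := by exact_mod_cast hn
  exact AbsoluteValue.trivial_apply this

theorem point_val (v : RatPlace) (n : ℤ) : v.point.val n = v.abs n := rfl

theorem center_mem_U {N : ℤ} (hN : N ≠ 0) : center ∈ U N := by
  simp [U, center_val_of_ne_zero hN]

theorem point_mem_U (v : RatPlace) {N : ℤ} (hN : N ≠ 0) : v.point ∈ U N := by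
  simpa [U, point_val] using hN

theorem exists_finite_pi_subset_of_mem_nhds_center {O : Set BerkovichInt} (hO : O ∈ 𝓝 center) :
    ∃ I : Set ℤ, I.Finite ∧ ∃ t : ℤ → Set ℝ, (∀ n, t n ∈ 𝓝 (center.val n)) ∧
      ∀ x : BerkovichInt, (∀ n ∈ I, x.val n ∈ t n) → x ∈ O := by
  rw [nhds_induced, mem_comap] at hO
  obtain ⟨s, hs, hsO⟩ := hO
  rw [nhds_pi, Filter.mem_pi] at hs
  obtain ⟨I, hI, t, ht, hts⟩ := hs
  exact ⟨I, hI, t, ht, fun x hx => hsO (hts hx)⟩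

/-- A neighbourhood of the central point contains entirely almost all the branches of `M(ℤ)`. -/
theorem exists_finite_forall_mem_of_mem_nhds_center {O : Set BerkovichInt} (hO : O ∈ 𝓝 center) :
    ∃ S : Set RatPlace, S.Finite ∧ RatPlace.infinite ∈ S ∧ ∀ v ∉ S, ∀ η : ℝ, 0 < η →
      ∀ x : BerkovichInt, (∀ n, x.val n = v.abs n ^ η) → x ∈ O := by
  obtain ⟨I, hI, t, ht, hIt⟩ := exists_finite_pi_subset_of_mem_nhds_center hO
  -- A neighbourhood constrains finitely many integers. If p divides none of the nonzero ones, they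
  -- have p-adic absolute value 1, as at the centre, and so do all powers.
  refine ⟨insert .infinite (⋃ n ∈ I, RatPlace.finite '' {p : Nat.Primes | n ≠ 0 ∧ (p : ℤ) ∣ n}),
    ?_, Set.mem_insert _ _, fun v hv η hη x hx => hIt x fun n hn => ?_⟩
  · refine (hI.biUnion fun n _ => Set.Finite.image _ ?_).insert _
    refine Set.Finite.of_finite_image (f := fun p : Nat.Primes => (p : ℕ))
      (n.natAbs.primeFactors.finite_toSet.subset ?_) Subtype.val_injective.injOn
    rintro _ ⟨p, ⟨hn, hp⟩, rfl⟩
    exact Nat.mem_primeFactors.2 ⟨p.2, Int.natCast_dvd.1 hp, Int.natAbs_ne_zero.2 hn⟩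
  · rw [Set.mem_insert_iff, not_or] at hv
    suffices x.val n = center.val n from this ▸ mem_of_mem_nhds (ht n)
    rw [hx]
    rcases eq_or_ne n 0 with rfl | hn0
    · rw [center_val_zero, Int.cast_zero, map_zero, Real.zero_rpow hη.ne']
    rw [center_val_of_ne_zero hn0]
    cases v with
    | infinite => exact absurd rfl hv.1
    | finite p =>
      have : Fact (p : ℕ).Prime := ⟨p.2⟩
      have hpn : ¬ (p : ℤ) ∣ n := fun hp =>
        hv.2 (Set.mem_biUnion hn ⟨p, ⟨hn0, hp⟩, rfl⟩)
      have h1 : RatPlace.abs (.finite p) (n : ℚ) = 1 := by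
        simp [RatPlace.abs, (padicNorm.int_eq_one_iff n).2 hpn]
      rw [h1, Real.one_rpow]

/-- A neighbourhood of the central point contains an initial segment of every branch. -/
theorem exists_pos_forall_mem_of_mem_nhds_center {O : Set BerkovichInt} (hO : O ∈ 𝓝 center)
    (v : RatPlace) : ∃ δ : ℝ, 0 < δ ∧ ∀ η : ℝ, 0 < η → η ≤ δ →
      ∀ x : BerkovichInt, (∀ n, x.val n = v.abs n ^ η) → x ∈ O := by
  obtain ⟨I, hI, t, ht, hIt⟩ := exists_finite_pi_subset_of_mem_nhds_center hO
  -- For n ≠ 0, |n|_v ^ η tends to 1 as η → 0. The integer 0 is set apart because 0 ^ 0 = 1.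
  have hev : ∀ᶠ η : ℝ in 𝓝 0, ∀ n ∈ I, n ≠ 0 → v.abs n ^ η ∈ t n := by
    refine (eventually_all_finite hI).2 fun n _ => ?_
    rcases eq_or_ne n 0 with rfl | hn
    · simp
    have hc : Tendsto (fun η : ℝ => v.abs n ^ η) (𝓝 0) (𝓝 (center.val n)) := by
      rw [center_val_of_ne_zero hn, ← Real.rpow_zero (v.abs n)]
      exact (Real.continuous_const_rpow (by simpa using hn)).tendsto 0
    filter_upwards [hc (ht n)] with η hη _ using hη
  obtain ⟨δ, hδ, h⟩ := Metric.eventually_nhds_iff.1 hev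
  refine ⟨δ / 2, half_pos hδ, fun η hη hηδ x hx => hIt x fun n hn => ?_⟩
  rw [hx]
  rcases eq_or_ne n 0 with rfl | hn0
  · rw [Int.cast_zero, map_zero, Real.zero_rpow hη.ne', ← center_val_zero]
    exact mem_of_mem_nhds (ht 0)
  · refine h ?_ n hn hn0
    rw [Real.dist_0_eq_abs, abs_of_pos hη]
    linarith

end BerkovichInt

/-! ### The flow on the analytification. -/

namespace Analytification

variable {X : Scheme.{0}}

theorem exists_isPow_of_le_one (y : Analytification X) {η : ℝ} (hη : 0 < η) (hη1 : η ≤ 1) :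
    ∃ y', IsPow η y y' :=
  let ⟨b, hb⟩ := y.abs.exists_rpow_of_le_one hη hη1
  ⟨_, b, hb, rfl⟩

theorem exists_isPow_of_natCast_le_one (y : Analytification X) (hy : ∀ n : ℕ, y.abs n ≤ 1)
    {η : ℝ} (hη : 0 < η) : ∃ y', IsPow η y y' :=
  let ⟨b, hb⟩ := y.abs.exists_rpow_of_natCast_le_one hy hη
  ⟨_, b, hb, rfl⟩

theorem IsPow.inv {η : ℝ} (hη : η ≠ 0) {y y' : Analytification X} (h : IsPow η y y') :
    IsPow η⁻¹ y' y := by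
  obtain ⟨b, hb, rfl⟩ := h
  exact ⟨y.abs, fun t => by rw [hb, Real.rpow_rpow_inv (y.abs.nonneg _) hη], rfl⟩

theorem IsPow.pr_val {η : ℝ} {y y' : Analytification X} (h : IsPow η y y') (n : ℤ) :
    (pr y').val n = (pr y).val n ^ η := by
  obtain ⟨b, hb, rfl⟩ := h
  exact hb n

/-- Homogeneity is assumed only for exponents at most 1; a larger exponent is reached by applying it
to the inverse flow. -/
theorem IsLogFloating.apply_isPow {V : Set (Analytification X)} {f : V → EReal}
    (hf : IsLogFloating V f) {η : ℝ} (hη : 0 < η) {y y' : V} (h : IsPow η y.1 y'.1) :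
    f y' = (η : EReal) * f y := by
  rcases le_or_gt η 1 with h1 | h1
  · exact hf y y' η hη h1 h
  · rw [hf y' y η⁻¹ (inv_pos.2 hη) (inv_le_one_of_one_le₀ h1.le) (h.inv hη.ne'), ← mul_assoc,
      ← EReal.coe_mul, mul_inv_cancel₀ hη.ne', EReal.coe_one, one_mul]

theorem IsLogFloating.apply_isPow_real {V : Set (Analytification X)} {f : V → ℝ}
    (hf : IsLogFloating V fun y => (f y : EReal)) {η : ℝ} (hη : 0 < η) {y y' : V}
    (h : IsPow η y.1 y'.1) : f y' = η * f y := by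
  exact_mod_cast hf.apply_isPow hη h

end Analytification

/-! ### The pointwise inequality. -/

namespace Analytification

variable {X : Scheme.{0}} {V : Set (Analytification X)} {NV : ℤ} {hNV : pr '' V = BerkovichInt.U NV}
  {E f₁ f₂ : V → ℝ} {g₁ : V → EReal}

/-- The fibres of a proper map are compact. -/
theorem bddAbove_of_isProperMap (hf₂ : Continuous f₂) {s t : ℝ}
    (hp : IsProperMap (Set.domRestrict {y : V | f₁ y ≤ s ∧ g₁ y ≤ ((t * f₂ y : ℝ) : EReal)}
      (prRestrict V NV hNV))) {a : BerkovichInt} (ha : a ∈ BerkovichInt.U NV) :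
    ∃ R : ℝ, ∀ y : V, f₁ y ≤ s → g₁ y ≤ ((t * f₂ y : ℝ) : EReal) → pr y.1 = a → f₂ y ≤ R := by
  obtain ⟨R, hR⟩ := (hp.isCompact_preimage (isCompact_singleton (x := ⟨a, ha⟩))).bddAbove_image
    (hf₂.comp continuous_subtype_val).continuousOn
  exact ⟨R, fun y h1 h2 h3 => hR ⟨⟨y, h1, h2⟩, Subtype.ext h3, rfl⟩⟩

/-- The points of `V` that are normalized by `f₁ = 1` and lie over a suitable neighbourhood of the
central point satisfy the inequality that holds over the central point, up to a factor `2`. -/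
theorem exists_mem_nhds_center (hN : NV ≠ 0)
    (hE : Continuous E) (hf₁ : Continuous f₁) (hf₂ : Continuous f₂) {t r ε : ℝ}
    (hp : IsProperMap (Set.domRestrict {y : V | f₁ y ≤ 1 ∧ g₁ y ≤ ((t * f₂ y : ℝ) : EReal)}
      (prRestrict V NV hNV))) (hr : 0 < r) (hε : 0 < ε)
    (hcentral : ∀ y : V, 0 ≤ f₂ y → g₁ y ≤ ((t * f₂ y : ℝ) : EReal) →
        pr y.1 = BerkovichInt.center → 1 / r * f₂ y ≤ E y) :
    ∃ R : ℝ, ε ≤ R ∧ ∃ O ∈ 𝓝 BerkovichInt.center, ∀ y : V, pr y.1 ∈ O → f₁ y = 1 → ε ≤ f₂ y →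
      g₁ y ≤ ((t * f₂ y : ℝ) : EReal) → f₂ y ≤ 2 * r * E y ∧ f₂ y ≤ R := by
  obtain ⟨R, hR⟩ := bddAbove_of_isProperMap hf₂ hp (BerkovichInt.center_mem_U hN)
  set D : Set V := {y : V | f₁ y ≤ 1 ∧ g₁ y ≤ ((t * f₂ y : ℝ) : EReal)}
  -- `Z` collects the normalized points violating the conclusion. Its image is closed by properness
  -- and will be shown to miss the centre: there f₂ ≤ r E and f₂ ≥ ε > 0 exclude 2r E ≤ f₂, while f₂
  -- ≤ R excludes the other alternative.
  let Z : Set D := {y | 1 ≤ f₁ y ∧ ε ≤ f₂ y ∧ (2 * r * E y ≤ f₂ y ∨ max R 0 + ε ≤ f₂ y)}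
  have hZ : IsClosed Z := by
    have h1 : Continuous fun y : D => E y := hE.comp continuous_subtype_val
    have h2 : Continuous fun y : D => f₁ y := hf₁.comp continuous_subtype_val
    have h3 : Continuous fun y : D => f₂ y := hf₂.comp continuous_subtype_val
    exact (isClosed_le continuous_const h2).inter ((isClosed_le continuous_const h3).inter
      ((isClosed_le (continuous_const.mul h1) h3).union (isClosed_le continuous_const h3)))
  obtain ⟨O, hO, hOZ⟩ := isOpen_induced_iff.1 (hp.isClosedMap _ hZ).isOpen_compl
  refine ⟨max R 0 + ε, le_add_of_nonneg_left (le_max_right _ _), O, hO.mem_nhds ?_,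
    fun y hyO hy1 hy2 hyg => ?_⟩
  · suffices (⟨_, BerkovichInt.center_mem_U hN⟩ : BerkovichInt.U NV) ∈ Subtype.val ⁻¹' O from this
    rw [hOZ]
    rintro ⟨⟨y, hyD⟩, ⟨-, hy2, hy⟩, hya⟩
    have hya' : pr y.1 = BerkovichInt.center := congrArg Subtype.val hya
    have h1 := hcentral y (hε.le.trans hy2) hyD.2 hya'
    have h2 := hR y hyD.1 hyD.2 hya'
    simp only at hy hy2
    rcases hy with hy | hy
    · rw [div_mul_eq_mul_div, one_mul, div_le_iff₀ hr] at h1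
      nlinarith
    · linarith [le_max_left R 0]
  · have hy : (⟨y, hy1.le, hyg⟩ : D) ∉ Z := by
      intro hyZ
      have : prRestrict V NV hNV y ∈ Subtype.val ⁻¹' O := hyO
      rw [hOZ] at this
      exact this ⟨_, hyZ, rfl⟩
    have h : ¬ (2 * r * E y ≤ f₂ y ∨ max R 0 + ε ≤ f₂ y) := fun h => hy ⟨hy1.ge, hy2, h⟩
    push Not at h
    exact ⟨h.1.le, h.2.le⟩

/-- The pointwise form of the main inequality, with error terms that depend on the place only and
almost all vanish. -/
theorem exists_pointwise_bound (hV : IsFloating V) (hNV : pr '' V = BerkovichInt.U NV)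
    (hE : Continuous E) (hf₁ : Continuous f₁) (hf₂ : Continuous f₂)
    (hE_nonneg : ∀ y, 0 ≤ E y)
    (hE_log : IsLogFloating V (fun y => (E y : EReal)))
    (hf₁_log : IsLogFloating V (fun y => (f₁ y : EReal)))
    (hf₂_log : IsLogFloating V (fun y => (f₂ y : EReal)))
    (hg₁_log : IsLogFloating V g₁)
    (hproper : ∀ s t : ℝ, 0 < s → 0 < t →
      IsProperMap (Set.domRestrict {y : V | f₁ y ≤ s ∧ g₁ y ≤ ((t * f₂ y : ℝ) : EReal)}
        (prRestrict V NV hNV)))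
    (hbound : ∃ A : ℝ, 0 < A ∧ ∃ B : RatPlace → ℝ, B.support.Finite ∧
      ∀ v : RatPlace, ∀ y : V, pr y.1 = v.point → g₁ y ≤ ((A * f₁ y + B v : ℝ) : EReal))
    (hcentral : ∃ r₀ : ℝ, 0 < r₀ ∧ ∃ τ : ℝ → ℝ, (∀ r, 0 < r → 0 < τ r) ∧
      Tendsto τ atTop atTop ∧
      ∀ r, r₀ ≤ r → ∀ y : V, g₁ y ≤ ((τ r * f₂ y : ℝ) : EReal) →
        pr y.1 = BerkovichInt.center → 1 / r * f₂ y ≤ E y) {ε : ℝ} (hε : 0 < ε) :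
    ∃ c : ℝ, 0 < c ∧ ∃ R : ℝ, 0 ≤ R ∧ ∃ M : RatPlace → ℝ, M.support.Finite ∧ (∀ v, 0 ≤ M v) ∧
      ∀ v, ∀ q : V, pr q.1 = v.point → 0 < f₁ q →
        f₂ q ≤ c * E q + ε * f₁ q + M v ∧ f₂ q ≤ R * f₁ q + M v := by
  classical
  rcases eq_or_ne NV 0 with rfl | hN
  · refine ⟨1, one_pos, 0, le_rfl, 0, by simp, fun _ => le_rfl, fun v q _ => ?_⟩
    have : pr q.1 ∈ BerkovichInt.U 0 := hNV ▸ Set.mem_image_of_mem pr q.2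
    exact absurd (by simp [BerkovichInt.val]) this
  obtain ⟨A, hA, B, hB, hAB⟩ := hbound
  obtain ⟨r₀, hr₀, τ, -, hτ, hcentral⟩ := hcentral
  obtain ⟨b, hb⟩ := (hB.image B).bddAbove
  set b' := max b 0
  have hb' : ∀ v, B v ≤ b' := fun v => by
    by_cases hv : B v = 0
    · exact hv ▸ le_max_right _ _
    · exact (hb (Set.mem_image_of_mem B hv)).trans (le_max_left _ _)
  have hb'0 : 0 ≤ b' := le_max_right _ _
  -- If ε f₁ ≤ f₂, then A f₁ ≤ (A/ε) f₂. The other term absorbs `B v`, provided `B v = 0` or f₂ ≥ 1.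
  set t := A / ε + b'
  have ht : 0 < t := add_pos_of_pos_of_nonneg (div_pos hA hε) hb'0
  have hW : ∀ v, ∀ q : V, pr q.1 = v.point → ε * f₁ q ≤ f₂ q → 0 ≤ f₂ q → (B v = 0 ∨ 1 ≤ f₂ q) →
      g₁ q ≤ ((t * f₂ q : ℝ) : EReal) := by
    intro v q hq h1 h0 h2
    refine (hAB v q hq).trans (EReal.coe_le_coe_iff.2 ?_)
    have h3 : A * f₁ q ≤ A / ε * f₂ q := by
      rw [div_mul_eq_mul_div, le_div_iff₀ hε]
      nlinarith
    have h4 : B v ≤ b' * f₂ q := by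
      rcases h2 with h2 | h2
      · rw [h2]; positivity
      · nlinarith [hb' v]
    rw [add_mul]
    exact add_le_add h3 h4
  -- Once τ(r) ≥ t, the points of W_t with f₂ ≥ 0 lie in W_{τ(r)}.
  obtain ⟨r, hrτ, hrr₀⟩ := ((hτ.eventually_ge_atTop t).and (eventually_ge_atTop r₀)).exists
  have hr : 0 < r := hr₀.trans_le hrr₀
  obtain ⟨R, hεR, O, hO, hRO⟩ := exists_mem_nhds_center hN hE hf₁ hf₂ (hproper 1 t one_pos ht) hr
    hε fun y hy hyg => hcentral r hrr₀ y (hyg.trans (EReal.coe_le_coe_iff.2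
      (mul_le_mul_of_nonneg_right hrτ hy)))
  -- The exponent 1/f₁(q) normalizes q to f₁ = 1; the resulting inequalities are homogeneous and so
  -- scale back to q.
  have hscale : ∀ q : V, 0 < f₁ q → ε * f₁ q ≤ f₂ q → g₁ q ≤ ((t * f₂ q : ℝ) : EReal) →
      ∀ y', IsPow (f₁ q)⁻¹ q.1 y' → pr y' ∈ O → f₂ q ≤ 2 * r * E q ∧ f₂ q ≤ R * f₁ q := by
    intro q hq h1 hg y' hy' hyO
    have hη := inv_pos.2 hq
    lift y' to V using hV _ q.2 _ hη _ hy'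
    have h1' : f₁ y' = 1 := by
      rw [hf₁_log.apply_isPow_real hη hy', inv_mul_cancel₀ hq.ne']
    have h2' := hf₂_log.apply_isPow_real hη hy'
    have h3' := hE_log.apply_isPow_real hη hy'
    have h := hRO y' hyO h1' (by rw [h2', inv_mul_eq_div, le_div_iff₀ hq]; exact h1) (by
      rw [hg₁_log.apply_isPow hη hy', h2', mul_left_comm, EReal.coe_mul]
      exact mul_le_mul_of_nonneg_left hg (EReal.coe_nonneg.2 hη.le))
    rw [h2', h3', inv_mul_eq_div, inv_mul_eq_div, div_le_iff₀ hq, div_le_iff₀ hq] at h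
    refine ⟨h.1.trans_eq ?_, h.2⟩
    field_simp
  obtain ⟨S, hS, hSinf, hSO⟩ := BerkovichInt.exists_finite_forall_mem_of_mem_nhds_center hO
  choose δ hδ hδO using BerkovichInt.exists_pos_forall_mem_of_mem_nhds_center hO
  -- The cutoff on f₁ is complementary to the flow: beyond it, 1/f₁ is at most 1, so the power
  -- exists even at the infinite place, and at most δ_v, so the power lies over `O`.
  choose m hm using fun v : RatPlace => bddAbove_of_isProperMap hf₂
    (hproper (max 1 (δ v)⁻¹) t (lt_max_of_lt_left one_pos) ht) (BerkovichInt.point_mem_U v hN)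
  let M : RatPlace → ℝ := (S ∪ B.support).indicator fun v => max 1 (m v)
  have hM0 : ∀ v, 0 ≤ M v := fun v =>
    Set.indicator_nonneg (fun v _ => zero_le_one.trans (le_max_left _ _)) v
  refine ⟨2 * r, by positivity, R, hε.le.trans hεR, M,
    (hS.union hB).subset Set.support_indicator_subset, hM0, fun v q hq hq1 => ?_⟩
  have hE0 : 0 ≤ 2 * r * E q := mul_nonneg (by positivity) (hE_nonneg q)
  have hM := hM0 v
  have hRf : ε * f₁ q ≤ R * f₁ q := mul_le_mul_of_nonneg_right hεR hq1.le
  have hεf : 0 < ε * f₁ q := mul_pos hε hq1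
  suffices f₂ q ≤ ε * f₁ q ∨ f₂ q ≤ M v ∨ (f₂ q ≤ 2 * r * E q ∧ f₂ q ≤ R * f₁ q) by
    rcases this with h | h | ⟨h, h'⟩ <;> constructor <;> linarith
  by_cases h1 : f₂ q ≤ ε * f₁ q
  · exact .inl h1
  right
  replace h1 := (not_le.1 h1).le
  have h0 : 0 ≤ f₂ q := hεf.le.trans h1
  have hη := inv_pos.2 hq1
  by_cases hv : v ∈ S ∪ B.support
  · have hMv : M v = max 1 (m v) := Set.indicator_of_mem hv _
    by_cases h2 : f₂ q ≤ 1
    · exact .inl (h2.trans (hMv ▸ le_max_left _ _))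
    have hg := hW v q hq h1 h0 (.inr (not_le.1 h2).le)
    rcases le_or_gt (f₁ q) (max 1 (δ v)⁻¹) with h3 | h3
    · exact .inl ((hm v q h3 hg hq).trans (hMv ▸ le_max_right _ _))
    · right
      have h4 := max_lt_iff.1 h3
      obtain ⟨y', hy'⟩ := exists_isPow_of_le_one q.1 hη (inv_le_one_of_one_le₀ h4.1.le)
      exact hscale q hq1 h1 hg y' hy' (hδO v _ hη (inv_le_of_inv_le₀ (hδ v) h4.2.le) _ fun n => by
        rw [hy'.pr_val, hq, BerkovichInt.point_val])
  -- Here v is finite and its whole branch lies in `O`, so q can be normalized whatever the size of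
  -- f₁(q).
  · right
    rw [Set.mem_union, not_or, Function.notMem_support] at hv
    have hg := hW v q hq h1 h0 (.inl hv.2)
    obtain ⟨y', hy'⟩ := exists_isPow_of_natCast_le_one q.1 (fun n => by
      have := abs_intCast_of_pr_eq hq n
      rw [Int.cast_natCast] at this
      rw [this]
      cases v with
      | infinite => exact absurd hSinf hv.1
      | finite p =>
        have : Fact (p : ℕ).Prime := ⟨p.2⟩
        exact Rat.AbsoluteValue.padic_le_one p n) hη
    exact hscale q hq1 h1 hg y' hy' (hSO v hv.1 _ hη _ fun n => by
      rw [hy'.pr_val, hq, BerkovichInt.point_val])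

end Analytification

/-! ### Summation over the points determined by Q. -/

namespace Analytification

variable {X : Scheme.{0}} {V : Set (Analytification X)}

theorem posSum_eq_zero_of_nonpos (S : Set V) {φ : V → ℝ} (hφ : ∀ q, φ q ≤ 0) : posSum S φ = 0 := by
  simp [posSum, ENNReal.ofReal_of_nonpos (hφ _)]

theorem weightedSum_of_nonneg (S : Set V) {φ : V → ℝ} (hφ : ∀ q, 0 ≤ φ q) :
    weightedSum S φ = (posSum S φ : EReal) := by
  rw [weightedSum, posSum_eq_zero_of_nonpos S (φ := fun q => -φ q) fun q => neg_nonpos.2 (hφ q)]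
  simp

theorem posSum_mono_set {S T : Set V} (h : S ⊆ T) (φ : V → ℝ) : posSum S φ ≤ posSum T φ :=
  ENNReal.tsum_mono_subtype (fun q : V => (weight q.1 : ℝ≥0∞) * ENNReal.ofReal (φ q)) h

/-- A constant depending on the place only contributes at most the sum of its values. -/
theorem tsum_weight_mul_le (Q : Spec (.of (AlgebraicClosure ℚ)) ⟶ X) (S : Set V)
    (M : RatPlace → ℝ≥0∞) :
    ∑' q : S, (weight q.1.1 : ℝ≥0∞) *
      ∑' v, (localPoints Q v).indicator (fun _ => M v) q.1.1 ≤ ∑' v, M v := by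
  -- Exchanging the two sums leaves, for each v, `M v` times a total weight at most 1.
  simp only [← ENNReal.tsum_mul_left]
  rw [ENNReal.tsum_comm]
  refine ENNReal.tsum_le_tsum fun v => ?_
  calc ∑' q : S, (weight q.1.1 : ℝ≥0∞) * (localPoints Q v).indicator (fun _ => M v) q.1.1
      ≤ ∑' y : Analytification X,
          (weight y : ℝ≥0∞) * (localPoints Q v).indicator (fun _ => M v) y :=
        ENNReal.tsum_comp_le_tsum_of_injective
          (f := fun q : S => q.1.1)
          (Subtype.val_injective.comp Subtype.val_injective)
          (fun y => (weight y : ℝ≥0∞) * (localPoints Q v).indicator (fun _ => M v) y)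
    _ = ∑' y : Analytification X,
          (localPoints Q v).indicator (fun y => (weight y : ℝ≥0∞) * M v) y := by
        refine tsum_congr fun y => ?_
        by_cases hy : y ∈ localPoints Q v <;> simp [hy]
    _ = (∑' y : localPoints Q v, (weight y.1 : ℝ≥0∞)) * M v := by
        rw [← tsum_subtype (localPoints Q v) (fun y => (weight y : ℝ≥0∞) * M v),
          ENNReal.tsum_mul_right]
    _ ≤ M v := mul_le_of_le_one_left zero_le (tsum_weight_le_one Q v)

/-- Integration of a pointwise inequality over the points determined by a `ℚ̄`-point. -/
theorem posSum_le_of_pointwise (Q : Spec (.of (AlgebraicClosure ℚ)) ⟶ X) {S : Set V}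
    {φ f g : V → ℝ} {a b : ℝ} {M : RatPlace → ℝ} (ha : 0 ≤ a) (hb : 0 ≤ b) (hf : ∀ q, 0 ≤ f q)
    (hg : ∀ q, 0 ≤ g q)
    (h : ∀ q ∈ S, ∃ v, q.1 ∈ localPoints Q v ∧ φ q ≤ a * f q + b * g q + M v) :
    posSum S φ ≤ ENNReal.ofReal a * posSum S f + ENNReal.ofReal b * posSum S g +
      ∑' v, ENNReal.ofReal (M v) := by
  refine le_trans ?_ (add_le_add_right (tsum_weight_mul_le Q S fun v => ENNReal.ofReal (M v)) _)
  rw [posSum, posSum, posSum, ← ENNReal.tsum_mul_left, ← ENNReal.tsum_mul_left,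
    ← ENNReal.tsum_add, ← ENNReal.tsum_add]
  refine ENNReal.tsum_le_tsum fun q => ?_
  obtain ⟨v, hv, hq⟩ := h q.1 q.2
  have h1 : ENNReal.ofReal (M v) ≤
      ∑' v, (localPoints Q v).indicator (fun _ => ENNReal.ofReal (M v)) q.1.1 := by
    refine le_trans ?_ (ENNReal.le_tsum v)
    rw [Set.indicator_of_mem hv]
  calc (weight q.1.1 : ℝ≥0∞) * ENNReal.ofReal (φ q.1)
      ≤ (weight q.1.1 : ℝ≥0∞) * (ENNReal.ofReal a * ENNReal.ofReal (f q.1) +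
          ENNReal.ofReal b * ENNReal.ofReal (g q.1) + ENNReal.ofReal (M v)) := by
        gcongr
        refine (ENNReal.ofReal_le_ofReal hq).trans (ENNReal.ofReal_add_le.trans ?_)
        rw [ENNReal.ofReal_add (mul_nonneg ha (hf _)) (mul_nonneg hb (hg _)),
          ENNReal.ofReal_mul ha, ENNReal.ofReal_mul hb]
    _ ≤ _ := by
        rw [mul_add, mul_add, mul_left_comm _ (ENNReal.ofReal a),
          mul_left_comm _ (ENNReal.ofReal b)]
        gcongr

end Analytification

/-! ### Extended real arithmetic and the conclusion. -/

/-- If p or b is infinite, the `EReal` convention ⊤ - ⊤ = ⊥ makes the left side ⊥. Otherwise, unless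
e is infinite, this is real arithmetic, and the negative part b only helps. -/
theorem EReal.mul_sub_add_le_of_le {a b e p m : ℝ≥0∞} {c ε : ℝ} (hc : 0 < c) (hε : 0 < ε)
    (hm : m ≠ ⊤) (ha : p ≠ ⊤ → a ≠ ⊤)
    (h : a ≤ ENNReal.ofReal c * e + ENNReal.ofReal ε * p + m) :
    ((c⁻¹ : ℝ) : EReal) * ((a : EReal) - (b : EReal) - (ε : EReal) * (p : EReal)) +
      ((-(c⁻¹ * m.toReal) : ℝ) : EReal) ≤ (e : EReal) := by
  have hc' := inv_pos.2 hc
  by_cases hp : p = ⊤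
  · simp [hp, EReal.coe_mul_top_of_pos hε, EReal.coe_mul_bot_of_pos hc']
  by_cases he : e = ⊤
  · simp [he]
  lift a to ℝ≥0 using ha hp
  by_cases hb : b = ⊤
  · simp [hb, EReal.coe_mul_bot_of_pos hc']
  lift p to ℝ≥0 using hp
  lift e to ℝ≥0 using he
  lift b to ℝ≥0 using hb
  lift m to ℝ≥0 using hm
  have h' : (a : ℝ) ≤ c * e + ε * p + m := by
    have := ENNReal.toReal_mono (by finiteness) h
    rwa [ENNReal.toReal_add (by finiteness) (by finiteness),
      ENNReal.toReal_add (by finiteness) (by finiteness), ENNReal.toReal_mul, ENNReal.toReal_mul,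
      ENNReal.toReal_ofReal hc.le, ENNReal.toReal_ofReal hε.le] at this
  have key : c⁻¹ * (a - b - ε * p) + -(c⁻¹ * m) ≤ (e : ℝ) := by
    have : (e : ℝ) - (c⁻¹ * (a - b - ε * p) + -(c⁻¹ * m)) =
        c⁻¹ * (c * e + ε * p + m - a + b) := by
      field_simp
      ring
    rw [← _root_.sub_nonneg, this]
    exact mul_nonneg hc'.le (by linarith [b.coe_nonneg])
  simp only [EReal.coe_nnreal_eq_coe_real, ENNReal.coe_toReal]
  exact_mod_cast key

theorem mainTheorem10 (N : ℤ) (hN : N ≠ 0) (Y : Scheme.{0})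
    (str : Y ⟶ Spec (.of (Localization.Away N))) [LocallyOfFiniteType str]
    (hgen : ∃ x : Y, CharZero (Y.residueField x))
    (V : Set (Analytification Y)) (hV : Analytification.IsFloating V)
    (NV : ℤ) (hNV : Analytification.pr '' V = BerkovichInt.U NV)
    (E f₁ f₂ : V → ℝ) (g₁ : V → EReal)
    (hE : Continuous E) (hf₁ : Continuous f₁) (hf₂ : Continuous f₂) (hg₁ : Continuous g₁)
    (hE_nonneg : ∀ y, 0 ≤ E y) (hf₁_nonneg : ∀ y, 0 ≤ f₁ y) (hg₁_top : ∀ y, g₁ y ≠ ⊤)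
    (hE_log : Analytification.IsLogFloating V (fun y => (E y : EReal)))
    (hf₁_log : Analytification.IsLogFloating V (fun y => (f₁ y : EReal)))
    (hf₂_log : Analytification.IsLogFloating V (fun y => (f₂ y : EReal)))
    (hg₁_log : Analytification.IsLogFloating V g₁)
    -- properness
    (hproper : ∀ s t : ℝ, 0 < s → 0 < t →
      IsProperMap (Set.domRestrict {y : V | f₁ y ≤ s ∧ g₁ y ≤ ((t * f₂ y : ℝ) : EReal)}
        (Analytification.prRestrict V NV hNV)))
    -- bound at each place, with almost all constants zero
    (hbound : ∃ A : ℝ, 0 < A ∧ ∃ B : RatPlace → ℝ, B.support.Finite ∧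
      ∀ v : RatPlace, ∀ y : V, Analytification.pr y.1 = v.point →
        g₁ y ≤ ((A * f₁ y + B v : ℝ) : EReal))
    -- central lower bounds
    (hcentral : ∃ r₀ : ℝ, 0 < r₀ ∧ ∃ τ : ℝ → ℝ, (∀ r, 0 < r → 0 < τ r) ∧
      Tendsto τ atTop atTop ∧
      ∀ r, r₀ ≤ r → ∀ y : V, g₁ y ≤ ((τ r * f₂ y : ℝ) : EReal) →
        Analytification.pr y.1 = BerkovichInt.center → 1 / r * f₂ y ≤ E y) :
    ∀ ε : ℝ, 0 < ε → ∃ C : ℝ, 0 < C ∧ ∃ D : ℝ,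
      ∀ Q : Spec (.of (AlgebraicClosure ℚ)) ⟶ Y,
        let L : Set V := {q | q.1 ∈ Analytification.adelicPoints Q}
        let L₁ : Set V := {q | q ∈ L ∧ 0 < f₁ q}
        (Analytification.weightedSum L f₁ ≠ ⊤ → Analytification.posSum L₁ f₂ ≠ ⊤) ∧
        (C : EReal) * (Analytification.weightedSum L₁ f₂ -
            (ε : EReal) * Analytification.weightedSum L f₁) + (D : EReal) ≤
          Analytification.weightedSum L₁ E := by
  intro ε hε
  obtain ⟨c, hc, R, hR, M, hM, hM0, h⟩ := Analytification.exists_pointwise_bound hV hNV hE hf₁ hf₂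
    hE_nonneg hE_log hf₁_log hf₂_log hg₁_log hproper hbound hcentral hε
  have hMtop : ∑' v, ENNReal.ofReal (M v) ≠ ⊤ := by
    rw [tsum_eq_sum (s := hM.toFinset) fun v hv => by
      rw [Function.notMem_support.1 (mt hM.mem_toFinset.2 hv), ENNReal.ofReal_zero]]
    exact ENNReal.sum_ne_top.2 fun v _ => ENNReal.ofReal_ne_top
  refine ⟨c⁻¹, inv_pos.2 hc, -(c⁻¹ * (∑' v, ENNReal.ofReal (M v)).toReal), ?_⟩
  intro Q L L₁
  have hL : Analytification.posSum L₁ f₁ ≤ Analytification.posSum L f₁ :=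
    Analytification.posSum_mono_set (fun q hq => hq.1) f₁
  have hpt : ∀ q ∈ L₁, ∃ v, q.1 ∈ Analytification.localPoints Q v ∧
      f₂ q ≤ c * E q + ε * f₁ q + M v ∧ f₂ q ≤ R * f₁ q + M v := by
    rintro q ⟨hq, hq1⟩
    obtain ⟨v, hv⟩ := Set.mem_iUnion.1 hq
    exact ⟨v, hv, h v q hv.2 hq1⟩
  have hsum := Analytification.posSum_le_of_pointwise Q (S := L₁) hc.le hε.le hE_nonneg hf₁_nonneg
    fun q hq => (hpt q hq).imp fun v hv => ⟨hv.1, hv.2.1⟩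
  have hfin : Analytification.posSum L f₁ ≠ ⊤ → Analytification.posSum L₁ f₂ ≠ ⊤ := by
    intro hf
    -- With coefficient 0 on E, the bound f₂ ≤ R f₁ + M_v gives finiteness without any control of
    -- the sum of E.
    have := Analytification.posSum_le_of_pointwise Q (S := L₁) le_rfl hR hE_nonneg hf₁_nonneg
      fun q hq => (hpt q hq).imp fun v hv => ⟨hv.1, by simpa using hv.2.2⟩
    refine ne_top_of_le_ne_top ?_ this
    have hf' := ne_top_of_le_ne_top hf hL
    rw [ENNReal.ofReal_zero, zero_mul, zero_add]
    finiteness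
  rw [Analytification.weightedSum_of_nonneg L hf₁_nonneg,
    Analytification.weightedSum_of_nonneg L₁ hE_nonneg]
  refine ⟨fun hf => hfin fun h => hf (by rw [h, EReal.coe_ennreal_top]),
    EReal.mul_sub_add_le_of_le hc hε hMtop hfin (hsum.trans ?_)⟩
  gcongr
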